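/- Let $\mathbb{D}=\{z\in\mathbb{C}:|z|<1\}$ and let $\mathcal{H}$ be a reproducing kernel Hilbert space of analytic functions on $\mathbb{D}$ with the following properties: (P1) for every integer $j\ge 0$ and every $w\in\mathbb{D}$ there is a constant $C=C(j,w)$ with $|f^{(j)}(w)|\le C\|f\|$ for all $f\in\mathcal{H}$; (P2) if $f\in\mathcal{H}$ then $zf\in\mathcal{H}$; (P3) all monomials $z^j$, $j\ge 0$, belong to $\mathcal{H}$, and their closed linear span is $\mathcal{H}$; (P4) if $w\in\mathbb{D}$ and $f\in\mathcal{H}$, then the function $(Q_wf)(z)=\dfrac{f(z)-f(w)}{z-w}$ (with value $f'(w)$ at $z=w$) belongs to $\mathcal{H}$. Then the shift $S f=zf$ and the operators $Q_w$ are bounded on $\mathcal{H}$. Call $J\in\mathcal{H}\setminus\{0\}$ *$S$-inner* if $J\perp S^nJ$ for all $n\ge 1$, and let $[J]$ be the closed linear span of $\{S^nJ:n\ge 0\}$. Let $H^2$ denote the classical Hardy space of analytic functions $h$ on $\mathbb{D}$ with $\sup_{0\le r<1}\int_0^{2\pi}|h(re^{i\theta})|^2\,\frac{d\theta}{2\pi}<\infty$.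 A *Blaschke sequence* is a finite (possibly empty) or infinite sequence $(b_k)$ in $\mathbb{D}$, repetitions allowed, with $\sum_k(1-|b_k|)<\infty$. The zero set of a nonzero analytic function on $\mathbb{D}$ is the finite or infinite sequence of its zeros in $\mathbb{D}$, repeated according to multiplicity. **Theorem.** Suppose that $\|Q_0\|=1$, that $J\in\mathcal{H}$ is $S$-inner with zero set $W$, and that $f\in[J]\setminus\{0\}$. Then $f=Jh$ on $\mathbb{D}$ for some $h\in H^2$, and the zero set of $f$ is the union, counted with multiplicity, of $W$ and a Blaschke sequence. -/

import Mathlib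

open Complex.UnitDisc

/-- The extension by zero to the whole plane of a function on the open unit disc `𝔻`.  Only its
values and derivatives at points of the (open) disc are ever used. -/
noncomputable def toPlane (f : 𝔻 → ℂ) : ℂ → ℂ :=
  Function.extend (fun z : 𝔻 => (z : ℂ)) f 0

theorem toPlane_coe (f : 𝔻 → ℂ) (z : 𝔻) : toPlane f (z : ℂ) = f z :=
  Function.Injective.extend_apply Complex.UnitDisc.coe_injective f 0 z

theorem toPlane_add (f g : 𝔻 → ℂ) : toPlane (f + g) = toPlane f + toPlane g := by
  have h := Function.extend_add (fun z : 𝔻 => (z : ℂ)) f g 0 0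
  simpa [toPlane] using h

theorem toPlane_smul (c : ℂ) (f : 𝔻 → ℂ) : toPlane (c • f) = c • toPlane f := by
  have h := Function.extend_smul c (fun z : 𝔻 => (z : ℂ)) f 0
  simpa [toPlane] using h

section Spaces

variable (H : Type*) [NormedAddCommGroup H] [InnerProductSpace ℂ H] [RKHS ℂ H 𝔻 ℂ]

/-- A reproducing kernel Hilbert space of analytic functions on `𝔻` in which all derivatives of
point evaluations are bounded, which is stable under multiplication by `z` and under the difference
quotients `Q_w`, and which is the closed linear span of the monomials.  (Completeness is asked for
separately, by `CompleteSpace H`.)  Here `dslope g w z` is `(g z - g w) / (z - w)` for `z ≠ w`, and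
`deriv g w` for `z = w`. -/
structure IsAnalyticShiftSpace : Prop where
  analytic : ∀ f : H, AnalyticOnNhd ℂ (toPlane f) (Metric.ball 0 1)
  bounded_deriv : ∀ (j : ℕ) (w : 𝔻), ∃ C : ℝ, ∀ f : H,
    ‖iteratedDeriv j (toPlane f) (w : ℂ)‖ ≤ C * ‖f‖
  mul_z_mem : ∀ f : H, ∃ g : H, ∀ z : 𝔻, g z = (z : ℂ) * f z
  monomial_mem : ∀ j : ℕ, ∃ g : H, ∀ z : 𝔻, g z = (z : ℂ) ^ j
  monomials_span :
    (Submodule.span ℂ {g : H | ∃ j : ℕ, ∀ z : 𝔻, g z = (z : ℂ) ^ j}).topologicalClosure = ⊤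
  diffQuot_mem : ∀ (w : 𝔻) (f : H), ∃ g : H, ∀ z : 𝔻, g z = dslope (toPlane f) (w : ℂ) (z : ℂ)

end Spaces

section Operators

variable {H : Type*} [NormedAddCommGroup H] [InnerProductSpace ℂ H] [RKHS ℂ H 𝔻 ℂ]

/-- The shift `f ↦ z f` as a linear map. -/
noncomputable def shiftLin (hH : IsAnalyticShiftSpace H) : H →ₗ[ℂ] H where
  toFun f := (hH.mul_z_mem f).choose
  map_add' f g := by
    refine RKHS.ext fun z => ?_
    rw [(hH.mul_z_mem (f + g)).choose_spec z, RKHS.coe_add, RKHS.coe_add, Pi.add_apply,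
      Pi.add_apply, (hH.mul_z_mem f).choose_spec z, (hH.mul_z_mem g).choose_spec z, mul_add]
  map_smul' c f := by
    refine RKHS.ext fun z => ?_
    rw [(hH.mul_z_mem (c • f)).choose_spec z, RingHom.id_apply, RKHS.coe_smul, RKHS.coe_smul,
      Pi.smul_apply, Pi.smul_apply, (hH.mul_z_mem f).choose_spec z, smul_eq_mul, smul_eq_mul]
    ring

theorem shiftLin_apply (hH : IsAnalyticShiftSpace H) (f : H) (z : 𝔻) :
    shiftLin hH f z = (z : ℂ) * f z :=
  (hH.mul_z_mem f).choose_spec z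

/-- The difference quotient `Q_w` as a linear map. -/
noncomputable def diffQuotLin (hH : IsAnalyticShiftSpace H) (w : 𝔻) : H →ₗ[ℂ] H where
  toFun f := (hH.diffQuot_mem w f).choose
  map_add' f g := by
    have hw : (w : ℂ) ∈ Metric.ball (0 : ℂ) 1 := mem_ball_zero_iff.2 w.norm_lt_one
    refine RKHS.ext fun z => ?_
    rw [(hH.diffQuot_mem w (f + g)).choose_spec z, RKHS.coe_add, RKHS.coe_add,
      Pi.add_apply, (hH.diffQuot_mem w f).choose_spec z, (hH.diffQuot_mem w g).choose_spec z,
      toPlane_add]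
    rcases eq_or_ne (z : ℂ) w with h | h
    · rw [h, dslope_same, dslope_same, dslope_same]
      exact deriv_add (hH.analytic f _ hw).differentiableAt (hH.analytic g _ hw).differentiableAt
    · simp only [dslope_of_ne _ h, slope_def_field, Pi.add_apply]
      ring
  map_smul' c f := by
    have hw : (w : ℂ) ∈ Metric.ball (0 : ℂ) 1 := mem_ball_zero_iff.2 w.norm_lt_one
    refine RKHS.ext fun z => ?_
    rw [(hH.diffQuot_mem w (c • f)).choose_spec z, RingHom.id_apply, RKHS.coe_smul, RKHS.coe_smul,
      Pi.smul_apply, (hH.diffQuot_mem w f).choose_spec z, toPlane_smul]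
    rcases eq_or_ne (z : ℂ) w with h | h
    · rw [h, dslope_same, dslope_same]
      exact deriv_const_smul c (hH.analytic f _ hw).differentiableAt
    · simp only [dslope_of_ne _ h, slope_def_field, Pi.smul_apply, smul_eq_mul]
      ring

theorem diffQuotLin_apply (hH : IsAnalyticShiftSpace H) (w : 𝔻) (f : H) (z : 𝔻) :
    diffQuotLin hH w f z = dslope (toPlane f) (w : ℂ) (z : ℂ) :=
  (hH.diffQuot_mem w f).choose_spec z

/-- The functional `f ↦ f'(w)` is continuous. -/
theorem continuous_deriv_eval (hH : IsAnalyticShiftSpace H) (w : 𝔻) :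
    Continuous fun f : H => deriv (toPlane f) (w : ℂ) := by
  have hw : (w : ℂ) ∈ Metric.ball (0 : ℂ) 1 := mem_ball_zero_iff.2 w.norm_lt_one
  let D : H →ₗ[ℂ] ℂ :=
    { toFun := fun f => deriv (toPlane f) (w : ℂ)
      map_add' := fun f g => by
        rw [RKHS.coe_add, toPlane_add]
        exact deriv_add (hH.analytic f _ hw).differentiableAt (hH.analytic g _ hw).differentiableAt
      map_smul' := fun c f => by
        rw [RKHS.coe_smul, toPlane_smul]
        exact deriv_const_smul c (hH.analytic f _ hw).differentiableAt }
  obtain ⟨C, hC⟩ := hH.bounded_deriv 1 w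
  exact (D.mkContinuous C fun f => by simpa [D, iteratedDeriv_one] using hC f).continuous

variable [CompleteSpace H]

/-- The shift operator `S : H → H`, `(S f)(z) = z f(z)`; it is bounded by the closed graph
theorem. -/
noncomputable def shift (hH : IsAnalyticShiftSpace H) : H →L[ℂ] H :=
  ContinuousLinearMap.ofSeqClosedGraph (g := shiftLin hH) (by
    intro u x y hx hy
    refine RKHS.ext fun z => ?_
    have h1 := ((RKHS.continuous_eval z).tendsto y).comp hy
    have h2 := (((RKHS.continuous_eval z).tendsto x).comp hx).const_mul (z : ℂ)
    rw [shiftLin_apply]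
    refine tendsto_nhds_unique h1 (h2.congr fun n => ?_)
    simp only [Function.comp_apply]
    rw [shiftLin_apply])

theorem shift_apply (hH : IsAnalyticShiftSpace H) (f : H) (z : 𝔻) :
    shift hH f z = (z : ℂ) * f z :=
  shiftLin_apply hH f z

/-- The difference quotient operator `Q_w : H → H`, `(Q_w f)(z) = (f z - f w) / (z - w)`; it is
bounded by the closed graph theorem. -/
noncomputable def diffQuot (hH : IsAnalyticShiftSpace H) (w : 𝔻) : H →L[ℂ] H :=
  ContinuousLinearMap.ofSeqClosedGraph (g := diffQuotLin hH w) (by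
    intro u x y hx hy
    refine RKHS.ext fun z => ?_
    have h1 := ((RKHS.continuous_eval z).tendsto y).comp hy
    have h2 : Filter.Tendsto (fun n => dslope (toPlane (u n)) (w : ℂ) (z : ℂ)) Filter.atTop
        (nhds (dslope (toPlane x) (w : ℂ) (z : ℂ))) := by
      rcases eq_or_ne (z : ℂ) w with h | h
      · simp only [h, dslope_same]
        exact ((continuous_deriv_eval hH w).tendsto x).comp hx
      · simp only [dslope_of_ne _ h, slope_def_field, toPlane_coe]
        exact ((((RKHS.continuous_eval z).tendsto x).comp hx).sub
          (((RKHS.continuous_eval w).tendsto x).comp hx)).div_const _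
    rw [diffQuotLin_apply]
    refine tendsto_nhds_unique h1 (h2.congr fun n => ?_)
    simp only [Function.comp_apply]
    rw [diffQuotLin_apply])

theorem diffQuot_apply (hH : IsAnalyticShiftSpace H) (w : 𝔻) (f : H) (z : 𝔻) :
    diffQuot hH w f z = dslope (toPlane f) (w : ℂ) (z : ℂ) :=
  diffQuotLin_apply hH w f z

end Operators

section Inner

variable {H : Type*} [NormedAddCommGroup H] [InnerProductSpace ℂ H]

/-- A nonzero vector `v` is `T`-inner when `v ⟂ T ^ n v` for all `n ≥ 1`. -/
def IsInnerVector (T : H →L[ℂ] H) (v : H) : Prop :=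
  v ≠ 0 ∧ ∀ n : ℕ, 1 ≤ n → inner ℂ v ((T ^ n) v) = 0

/-- `[v]_T`, the closed linear span of `v, T v, T ^ 2 v, …`. -/
def cyclicSubspace (T : H →L[ℂ] H) (v : H) : Submodule ℂ H :=
  (Submodule.span ℂ (Set.range fun n : ℕ => (T ^ n) v)).topologicalClosure

end Inner

/-- The classical Hardy space `H²` of the disc: analytic functions with bounded quadratic
integral means over the circles of radius `r < 1`. -/
def MemHardyTwo (h : 𝔻 → ℂ) : Prop :=
  AnalyticOnNhd ℂ (toPlane h) (Metric.ball 0 1) ∧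
    ∃ C : ℝ, ∀ r : ℝ, 0 ≤ r → r < 1 →
      Real.circleAverage (fun z => ‖toPlane h z‖ ^ 2) 0 r ≤ C

/-- The family `w` lists the zeros of `f` in `𝔻`, each one repeated according to its
multiplicity. -/
def IsZeroSequence {ι : Type*} (f : 𝔻 → ℂ) (w : ι → 𝔻) : Prop :=
  ∀ z : 𝔻, analyticOrderAt (toPlane f) (z : ℂ) = {i | w i = z}.encard

/-- The Blaschke condition `∑ (1 - |b i|) < ∞` for a finite or infinite family of points of the
disc, repetitions allowed. -/
def IsBlaschkeSequence {κ : Type*} (b : κ → 𝔻) : Prop :=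
  Summable fun i => 1 - ‖(b i : ℂ)‖

/-! Since `Q₀ S = 1` and `‖Q₀‖ = 1`, the shift does not decrease norms. If `J` is inner, then `J` is
orthogonal to `S q(S) J`, so Pythagoras bounds `‖(a + S q(S)) J‖²` below by `|a|² ‖J‖² + ‖q(S) J‖²`.
Iterating along the Horner form of `p`, `‖p(S) J‖²` dominates `‖J‖²` times the sum of squares of the
coefficients of `p`. Coefficients never appear: `IsInnerVector.le_norm_sq_aeval` is applied to two
functionals obeying the same recursion, the quadratic mean over a circle and the weighted value `(1
- |z|²) |p z|²`. If `p n (S) J` tends to `f`, the second makes the `p n` converge locally uniformly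
to some `h`, the first puts `h` in `H²`, and evaluating at points gives `f = J h`. Jensen's formula
(`sum_analyticOrderNatAt_mul_log_le`) turns the bounded means of `h` into the Blaschke condition,
and orders of vanishing add in the product `J h`. -/

theorem Polynomial.induction_mul_X_add_C {R : Type*} [CommRing R] {P : Polynomial R → Prop}
    (zero : P 0) (step : ∀ (q : Polynomial R) (a : R), P q → P (q * X + C a))
    (p : Polynomial R) : P p := by
  induction h : p.natDegree using Nat.strong_induction_on generalizing p with
  | _ n ih =>
    by_cases hn : n = 0
    -- Degree zero is separate because `divX` does not lower it.
    · rw [Polynomial.eq_C_of_natDegree_eq_zero (h.trans hn)]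
      simpa using step 0 (p.coeff 0) zero
    · rw [← Polynomial.divX_mul_X_add p]
      refine step _ _ (ih _ ?_ _ rfl)
      rw [Polynomial.natDegree_divX_eq_natDegree_tsub_one, h]
      omega

/-! ### Lower bounds on the cyclic subspace of an inner vector -/

section InnerVector

variable {H : Type*} [NormedAddCommGroup H] [InnerProductSpace ℂ H]

open Polynomial in
theorem IsInnerVector.inner_aeval_mul_X {T : H →L[ℂ] H} {v : H} (hv : IsInnerVector T v)
    (q : ℂ[X]) : inner ℂ v (aeval T (q * X) v) = 0 := by
  induction q using Polynomial.induction_on' with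
  | add p q hp hq => simp only [add_mul, map_add, _root_.add_apply, inner_add_right,
      hp, hq, add_zero]
  | monomial n a =>
    rw [← C_mul_X_pow_eq_monomial, mul_assoc, ← pow_succ, map_mul, aeval_C, map_pow, aeval_X,
      ← Algebra.smul_def, _root_.smul_apply, inner_smul_right,
      hv.2 _ (Nat.le_add_left 1 n), mul_zero]

-- Pythagoras for `a • v` and `T (q(T) v)`, followed by the expansivity of `T`.
open Polynomial in
theorem IsInnerVector.norm_sq_aeval_mul_X_add_C {T : H →L[ℂ] H} {v : H} (hv : IsInnerVector T v)
    (hT : ∀ x, ‖x‖ ≤ ‖T x‖) (q : ℂ[X]) (a : ℂ) :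
    ‖a‖ ^ 2 * ‖v‖ ^ 2 + ‖aeval T q v‖ ^ 2 ≤ ‖aeval T (q * X + C a) v‖ ^ 2 := by
  have h1 : aeval T (q * X + C a) v = a • v + aeval T (q * X) v := by
    rw [map_add, aeval_C, Algebra.algebraMap_eq_smul_one, add_comm]
    simp
  have h2 : aeval T (q * X) v = T (aeval T q v) := by
    rw [mul_comm, map_mul, aeval_X, mul_apply_eq_comp]
  have h3 : inner ℂ (a • v) (aeval T (q * X) v) = 0 := by
    rw [inner_smul_left, hv.inner_aeval_mul_X, mul_zero]
  have h4 := norm_add_sq_eq_norm_sq_add_norm_sq_of_inner_eq_zero _ _ h3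
  have h5 := pow_le_pow_left₀ (norm_nonneg _) (hT (aeval T q v)) 2
  rw [← h2] at h5
  rw [norm_smul] at h4
  rw [h1]
  linarith

open Polynomial in
/-- A lower bound for the norm of `p(T) v` by any functional of `p` that obeys the recursion of
the squared `ℓ²`-norm of the coefficients. -/
theorem IsInnerVector.le_norm_sq_aeval {T : H →L[ℂ] H} {v : H} (hv : IsInnerVector T v)
    (hT : ∀ x, ‖x‖ ≤ ‖T x‖) {N : ℂ[X] → ℝ} (h0 : N 0 ≤ 0)
    (hN : ∀ q a, N (q * X + C a) ≤ ‖a‖ ^ 2 + N q) (p : ℂ[X]) :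
    N p * ‖v‖ ^ 2 ≤ ‖aeval T p v‖ ^ 2 := by
  induction p using Polynomial.induction_mul_X_add_C with
  | zero => simpa using mul_nonpos_of_nonpos_of_nonneg h0 (sq_nonneg ‖v‖)
  | step q a ih =>
    refine le_trans ?_ (hv.norm_sq_aeval_mul_X_add_C hT q a)
    nlinarith [mul_le_mul_of_nonneg_right (hN q a) (sq_nonneg ‖v‖)]

open Polynomial in
theorem exists_aeval_eq_of_mem_span {T : H →L[ℂ] H} {v x : H}
    (hx : x ∈ Submodule.span ℂ (Set.range fun n : ℕ => (T ^ n) v)) :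
    ∃ p : ℂ[X], aeval T p v = x := by
  induction hx using Submodule.span_induction with
  | mem x hx =>
    obtain ⟨n, rfl⟩ := hx
    exact ⟨X ^ n, by simp⟩
  | zero => exact ⟨0, by simp⟩
  | add x y _ _ hx hy =>
    obtain ⟨p, rfl⟩ := hx
    obtain ⟨q, rfl⟩ := hy
    exact ⟨p + q, by simp⟩
  | smul a x _ hx =>
    obtain ⟨p, rfl⟩ := hx
    exact ⟨a • p, by simp⟩

open Polynomial Filter in
theorem exists_tendsto_aeval_of_mem_cyclicSubspace {T : H →L[ℂ] H} {v f : H}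
    (hf : f ∈ cyclicSubspace T v) :
    ∃ p : ℕ → ℂ[X], Tendsto (fun n => aeval T (p n) v) atTop (nhds f) := by
  obtain ⟨u, hu, hlim⟩ := mem_closure_iff_seq_limit.1 hf
  choose p hp using fun n => exists_aeval_eq_of_mem_span (hu n)
  exact ⟨p, by simpa only [hp] using hlim⟩

end InnerVector

/-! ### Two functionals dominated by the squared `ℓ²`-norm of the coefficients -/

section Hardy

open Polynomial Real

/-- After the triangle inequality, the two sides differ by exactly the square `(|z| |a| - (1 - |z|²)
|q z|)²`. -/
theorem Polynomial.mul_norm_sq_eval_mul_X_add_C_le {z : ℂ} (hz : ‖z‖ < 1) (q : ℂ[X]) (a : ℂ) :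
    (1 - ‖z‖ ^ 2) * ‖(q * X + C a).eval z‖ ^ 2 ≤ ‖a‖ ^ 2 + (1 - ‖z‖ ^ 2) * ‖q.eval z‖ ^ 2 := by
  have h1 : ‖(q * X + C a).eval z‖ ≤ ‖q.eval z‖ * ‖z‖ + ‖a‖ := by
    simpa using norm_add_le (q.eval z * z) a
  have h2 := pow_le_pow_left₀ (norm_nonneg _) h1 2
  have h3 : 0 ≤ 1 - ‖z‖ ^ 2 := by nlinarith [norm_nonneg z]
  nlinarith [mul_le_mul_of_nonneg_left h2 h3, sq_nonneg (‖z‖ * ‖a‖ - (1 - ‖z‖ ^ 2) * ‖q.eval z‖)]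

theorem Polynomial.circleAverage_norm_sq_mul_X_add_C_le {r : ℝ} (hr0 : 0 ≤ r) (hr : r < 1)
    (q : ℂ[X]) (a : ℂ) :
    circleAverage (fun z => ‖(q * X + C a).eval z‖ ^ 2) 0 r ≤
      ‖a‖ ^ 2 + circleAverage (fun z => ‖q.eval z‖ ^ 2) 0 r := by
  have hci : ∀ {g : ℂ → ℝ}, Continuous g → CircleIntegrable g 0 r :=
    fun hg => hg.continuousOn.circleIntegrable hr0
  -- The real part of `F` is the cross term of `|z q + a|²`; its mean is `Re F(0) = 0`.
  let F : ℂ[X] := C (2 * (starRingEnd ℂ) a) * (q * X)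
  have hF : circleAverage (fun z => (F.eval z).re) 0 r = 0 := by
    have h1 : circleAverage (fun z => F.eval z) 0 r = F.eval 0 :=
      (F.differentiable.diffContOnCl).circleAverage
    have h2 := Complex.reCLM.circleAverage_comp_comm
      (f := fun z => F.eval z) (c := 0) (R := r) (F.continuous.continuousOn.circleIntegrable hr0)
    rw [h1] at h2
    simpa [F, Function.comp_def] using h2
  have hexp : Set.EqOn (fun z => ‖(q * X + C a).eval z‖ ^ 2)
      (fun z => (‖a‖ ^ 2 + r ^ 2 * ‖q.eval z‖ ^ 2) + (F.eval z).re) (Metric.sphere 0 |r|) := by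
    intro z hz
    have hzr : ‖z‖ = r := by simpa [abs_of_nonneg hr0] using hz
    simp only [F, eval_add, eval_mul, eval_C, eval_X, ← hzr, Complex.sq_norm,
      Complex.normSq_apply, Complex.add_re, Complex.add_im, Complex.mul_re, Complex.mul_im,
      Complex.conj_re, Complex.conj_im, Complex.re_ofNat, Complex.im_ofNat]
    ring
  rw [circleAverage_congr_sphere hexp, circleAverage_fun_add (hci (by fun_prop))
    (hci (by fun_prop)), hF, circleAverage_fun_add (hci (by fun_prop)) (hci (by fun_prop)),
    circleAverage_const, add_zero]
  have h3 := circleAverage_fun_smul (a := r ^ 2) (f := fun z => ‖q.eval z‖ ^ 2) (c := 0) (R := r)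
  simp only [smul_eq_mul] at h3
  rw [h3]
  have h4 : 0 ≤ circleAverage (fun z => ‖q.eval z‖ ^ 2) 0 r :=
    circleAverage_nonneg_of_nonneg fun z _ => sq_nonneg _
  have h5 : r ^ 2 ≤ 1 := by nlinarith
  nlinarith

end Hardy

/-! ### Passage to the limit -/

section Limit

open Real Filter Topology

theorem circleAverage_norm_sq_le_of_norm_sub_le {f g : ℂ → ℂ} {r C : ℝ} (hr : 0 ≤ r)
    (hf : ContinuousOn f (Metric.sphere 0 r)) (hg : ContinuousOn g (Metric.sphere 0 r))
    (hfg : ∀ z ∈ Metric.sphere 0 r, ‖g z - f z‖ ≤ 1)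
    (hC : circleAverage (fun z => ‖f z‖ ^ 2) 0 r ≤ C) :
    circleAverage (fun z => ‖g z‖ ^ 2) 0 r ≤ 2 * C + 2 := by
  have hfi : CircleIntegrable (fun z => ‖f z‖ ^ 2) 0 r := (hf.norm.pow 2).circleIntegrable hr
  have hgi : CircleIntegrable (fun z => ‖g z‖ ^ 2) 0 r := (hg.norm.pow 2).circleIntegrable hr
  have h2f : CircleIntegrable (fun z => 2 * ‖f z‖ ^ 2) 0 r :=
    ((hf.norm.pow 2).const_mul 2).circleIntegrable hr
  have h2 : CircleIntegrable (fun _ => (2 : ℝ)) 0 r := continuousOn_const.circleIntegrable hr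
  calc circleAverage (fun z => ‖g z‖ ^ 2) 0 r
      ≤ circleAverage (fun z => 2 * ‖f z‖ ^ 2 + 2) 0 r := by
        refine circleAverage_mono hgi (h2f.add h2) fun z hz => ?_
        rw [abs_of_nonneg hr] at hz
        have h3 : ‖g z‖ ≤ ‖f z‖ + 1 := by
          have := norm_add_le (g z - f z) (f z)
          rw [sub_add_cancel] at this
          linarith [hfg z hz]
        nlinarith [norm_nonneg (g z), sq_nonneg (‖f z‖ - 1)]
    _ = 2 * circleAverage (fun z => ‖f z‖ ^ 2) 0 r + 2 := by
        have h3 := circleAverage_fun_smul (a := (2 : ℝ)) (f := fun z => ‖f z‖ ^ 2) (c := 0) (R := r)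
        simp only [smul_eq_mul] at h3
        rw [circleAverage_fun_add h2f h2, circleAverage_const, h3]
    _ ≤ 2 * C + 2 := by linarith

/-- A sequence of entire functions that is Cauchy for the weighted sup-norm of `H²` and has bounded
quadratic means converges pointwise on the disc to a function with bounded quadratic means. -/
theorem exists_tendsto_of_cauchy_weighted {F : ℕ → ℂ → ℂ} (hF : ∀ n, Differentiable ℂ (F n))
    {C : ℝ} (hC : ∀ n r, 0 ≤ r → r < 1 → circleAverage (fun z => ‖F n z‖ ^ 2) 0 r ≤ C)
    (hcau : ∀ ε > 0, ∃ N, ∀ m ≥ N, ∀ n ≥ N, ∀ z : ℂ, ‖z‖ < 1 →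
      (1 - ‖z‖ ^ 2) * ‖F m z - F n z‖ ^ 2 ≤ ε) :
    ∃ g : ℂ → ℂ, DifferentiableOn ℂ g (Metric.ball 0 1) ∧
      (∀ z ∈ Metric.ball (0 : ℂ) 1, Tendsto (fun n => F n z) atTop (𝓝 (g z))) ∧
      ∀ r, 0 ≤ r → r < 1 → circleAverage (fun z => ‖g z‖ ^ 2) 0 r ≤ 2 * C + 2 := by
  have hunif : ∀ r : ℝ, 0 ≤ r → r < 1 → UniformCauchySeqOn F atTop (Metric.closedBall 0 r) := by
    intro r hr0 hr
    rw [Metric.uniformCauchySeqOn_iff]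
    intro ε hε
    have hr2 : 0 < 1 - r ^ 2 := by nlinarith
    -- Half of `ε`, since the Cauchy bound is not strict but the goal is.
    obtain ⟨N, hN⟩ := hcau ((1 - r ^ 2) * (ε / 2) ^ 2) (by positivity)
    refine ⟨N, fun m hm n hn z hz => ?_⟩
    have hzr : ‖z‖ ≤ r := mem_closedBall_zero_iff.1 hz
    have h1 := hN m hm n hn z (hzr.trans_lt hr)
    have h2 : (1 - r ^ 2) * ‖F m z - F n z‖ ^ 2 ≤ (1 - r ^ 2) * (ε / 2) ^ 2 :=
      (mul_le_mul_of_nonneg_right (by nlinarith [norm_nonneg z]) (sq_nonneg _)).trans h1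
    have h3 := abs_le_of_sq_le_sq' (le_of_mul_le_mul_left h2 hr2) (by positivity)
    rw [dist_eq_norm]
    linarith [h3.2]
  have hpt : ∀ z : ℂ, ∃ w, z ∈ Metric.ball (0 : ℂ) 1 → Tendsto (fun n => F n z) atTop (𝓝 w) := by
    intro z
    by_cases hz : z ∈ Metric.ball (0 : ℂ) 1
    · obtain ⟨w, hw⟩ := cauchySeq_tendsto_of_complete
        ((hunif ‖z‖ (norm_nonneg z) (mem_ball_zero_iff.1 hz)).cauchySeq (x := z) (by simp))
      exact ⟨w, fun _ => hw⟩
    · exact ⟨0, fun h => absurd h hz⟩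
  choose g hg using hpt
  have hlim : ∀ r : ℝ, 0 ≤ r → r < 1 → TendstoUniformlyOn F g atTop (Metric.closedBall 0 r) :=
    fun r hr0 hr => (hunif r hr0 hr).tendstoUniformlyOn_of_tendsto fun z hz =>
      hg z (Metric.closedBall_subset_ball hr hz)
  have hdiff : DifferentiableOn ℂ g (Metric.ball 0 1) := by
    refine TendstoLocallyUniformlyOn.differentiableOn (F := F) (φ := atTop) ?_
      (Eventually.of_forall fun n => (hF n).differentiableOn) Metric.isOpen_ball
    rw [Metric.tendstoLocallyUniformlyOn_iff]
    intro ε hε z hz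
    obtain ⟨r, hzr, hr⟩ := exists_between (mem_ball_zero_iff.1 hz)
    refine ⟨Metric.closedBall 0 r, mem_nhdsWithin_of_mem_nhds
      (Metric.closedBall_mem_nhds_of_mem (mem_ball_zero_iff.2 hzr)), ?_⟩
    exact Metric.tendstoUniformlyOn_iff.1 (hlim r ((norm_nonneg z).trans hzr.le) hr) ε hε
  refine ⟨g, hdiff, hg, fun r hr0 hr => ?_⟩
  -- One approximant within distance 1 on the circle suffices, because `C` is independent of `n` and
  -- `r`.
  obtain ⟨n, hn⟩ := (Metric.tendstoUniformlyOn_iff.1 (hlim r hr0 hr) 1 one_pos).exists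
  exact circleAverage_norm_sq_le_of_norm_sub_le hr0 (hF n).continuous.continuousOn
    (hdiff.continuousOn.mono (Metric.sphere_subset_closedBall.trans
      (Metric.closedBall_subset_ball hr)))
    (fun z hz => dist_eq_norm (g z) _ ▸ (hn z (Metric.sphere_subset_closedBall hz)).le) (hC n r hr0 hr)

end Limit

/-! ### Jensen's formula and the Blaschke condition -/

section Zeros

open Real Filter Topology MeromorphicOn

theorem circleAverage_log_norm_le {f : ℂ → ℂ} {R C : ℝ} (hR : 0 ≤ R)
    (hf : AnalyticOnNhd ℂ f (Metric.closedBall 0 |R|))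
    (hC : circleAverage (fun z => ‖f z‖ ^ 2) 0 R ≤ C) :
    circleAverage (fun z => log ‖f z‖) 0 R ≤ C := by
  have hf' : AnalyticOnNhd ℂ f (Metric.sphere 0 |R|) := hf.mono Metric.sphere_subset_closedBall
  refine le_trans (circleAverage_mono hf'.meromorphicOn.circleIntegrable_log_norm ?_ ?_) hC
  · refine (ContinuousOn.pow ?_ 2).circleIntegrable hR
    exact (abs_of_nonneg hR ▸ hf').continuousOn.norm
  · intro z _
    -- At a zero the convention `log 0 = 0` applies; elsewhere `log x ≤ x - 1 ≤ x²`.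
    rcases (norm_nonneg (f z)).eq_or_lt with h | h
    · simp [← h]
    · nlinarith [log_le_sub_one_of_pos h, sq_nonneg (‖f z‖ - 1)]

end Zeros

section Zeros

open Real Filter Topology MeromorphicOn

/-- Jensen's formula, with the zeros outside `s` dropped since their terms are nonnegative. The
order and trailing coefficient at 0 allow `f 0 = 0`. -/
theorem sum_analyticOrderNatAt_mul_log_le {f : ℂ → ℂ} {R C : ℝ} (hR : 0 < R)
    (hf : AnalyticOnNhd ℂ f (Metric.closedBall 0 |R|))
    (hC : circleAverage (fun z => ‖f z‖ ^ 2) 0 R ≤ C)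
    (s : Finset ℂ) (hs : ∀ z ∈ s, z ≠ 0 ∧ ‖z‖ ≤ R) :
    ∑ z ∈ s, analyticOrderNatAt f z * log (R * ‖z‖⁻¹) ≤
      C - analyticOrderNatAt f 0 * log R - log ‖meromorphicTrailingCoeffAt f 0‖ := by
  have hdiv : ∀ z ∈ Metric.closedBall (0 : ℂ) |R|,
      (divisor f (Metric.closedBall 0 |R|) z : ℝ) = analyticOrderNatAt f z := by
    intro z hz
    rw [hf.divisor_apply hz, analyticOrderNatAt]
    cases analyticOrderAt f z <;> simp
  have hle := circleAverage_log_norm_le hR.le hf hC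
  rw [hf.meromorphicOn.circleAverage_log_norm hR.ne', hdiv 0 (by simp)] at hle
  let D := divisor f (Metric.closedBall 0 |R|)
  have hfin := D.finiteSupport (isCompact_closedBall 0 |R|)
  have hsum : ∑ᶠ u, (D u : ℝ) * log (R * ‖0 - u‖⁻¹) =
      ∑ u ∈ s ∪ hfin.toFinset, (D u : ℝ) * log (R * ‖u‖⁻¹) := by
    rw [finsum_eq_sum_of_support_subset (s := s ∪ hfin.toFinset)]
    · simp
    · intro u hu
      have : D u ≠ 0 := fun h => hu (by simp [h])
      simp [this]
  have hmono : ∑ z ∈ s, analyticOrderNatAt f z * log (R * ‖z‖⁻¹) ≤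
      ∑ u ∈ s ∪ hfin.toFinset, (D u : ℝ) * log (R * ‖u‖⁻¹) := by
    rw [Finset.sum_congr rfl fun z hz => by
      rw [← hdiv z (by simpa [abs_of_pos hR] using (hs z hz).2)]]
    refine Finset.sum_le_sum_of_subset_of_nonneg Finset.subset_union_left fun u _ _ => ?_
    by_cases hu : u ∈ Metric.closedBall (0 : ℂ) |R|
    · refine mul_nonneg (by rw [hdiv u hu]; positivity) ?_
      rcases eq_or_ne u 0 with rfl | hu0
      · simp
      · refine log_nonneg ?_
        rw [← div_eq_mul_inv, one_le_div (norm_pos_iff.2 hu0)]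
        simpa [abs_of_pos hR] using hu
    · simp [hu]
  rw [hsum] at hle
  linarith

/-- Let `R → 1` in the previous bound and use `1 - |z| ≤ -log |z|`. -/
theorem sum_analyticOrderNatAt_mul_one_sub_norm_le {f : ℂ → ℂ} {C : ℝ}
    (hf : AnalyticOnNhd ℂ f (Metric.ball 0 1))
    (hC : ∀ r : ℝ, 0 ≤ r → r < 1 → circleAverage (fun z => ‖f z‖ ^ 2) 0 r ≤ C)
    (s : Finset ℂ) (hs : ∀ z ∈ s, z ≠ 0 ∧ ‖z‖ < 1) :
    ∑ z ∈ s, analyticOrderNatAt f z * (1 - ‖z‖) ≤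
      C - log ‖meromorphicTrailingCoeffAt f 0‖ := by
  have hR0 : ∀ᶠ R : ℝ in 𝓝[<] 1, 0 < R := mem_nhdsWithin_of_mem_nhds (Ioi_mem_nhds one_pos)
  have hRs : ∀ᶠ R : ℝ in 𝓝[<] 1, ∀ z ∈ s, ‖z‖ ≤ R := by
    rw [Finset.eventually_all]
    exact fun z hz => mem_nhdsWithin_of_mem_nhds (Ici_mem_nhds (hs z hz).2)
  have hle : ∀ᶠ R : ℝ in 𝓝[<] 1, ∑ z ∈ s, analyticOrderNatAt f z * log (R * ‖z‖⁻¹) ≤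
      C - analyticOrderNatAt f 0 * log R - log ‖meromorphicTrailingCoeffAt f 0‖ := by
    filter_upwards [hR0, hRs, self_mem_nhdsWithin] with R h0 h1 h2
    refine sum_analyticOrderNatAt_mul_log_le h0 (hf.mono ?_) (hC R h0.le h2) s
      fun z hz => ⟨(hs z hz).1, h1 z hz⟩
    rw [abs_of_pos h0]
    exact Metric.closedBall_subset_ball h2
  have hlog : Tendsto log (𝓝[<] 1) (𝓝 0) := by
    simpa using (continuousAt_log one_ne_zero).tendsto.mono_left nhdsWithin_le_nhds
  have hid : Tendsto (fun R : ℝ => R) (𝓝[<] 1) (𝓝 1) := nhdsWithin_le_nhds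
  have hlim1 : Tendsto (fun R => ∑ z ∈ s, analyticOrderNatAt f z * log (R * ‖z‖⁻¹)) (𝓝[<] 1)
      (𝓝 (∑ z ∈ s, analyticOrderNatAt f z * log (1 * ‖z‖⁻¹))) := by
    refine tendsto_finsetSum _ fun z hz => ((hid.mul_const _).log ?_).const_mul _
    simpa using (hs z hz).1
  have hlim2 := ((hlog.const_mul (analyticOrderNatAt f 0 : ℝ)).const_sub C).sub_const
    (log ‖meromorphicTrailingCoeffAt f 0‖)
  refine le_trans (Finset.sum_le_sum fun z hz => ?_)
    ((le_of_tendsto_of_tendsto hlim1 hlim2 hle).trans (by simp))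
  refine mul_le_mul_of_nonneg_left ?_ (Nat.cast_nonneg _)
  rw [one_mul, log_inv]
  linarith [log_le_sub_one_of_pos (norm_pos_iff.2 (hs z hz).1)]

/-- The zeros of an `H²` function, listed with multiplicity, satisfy the Blaschke condition. -/
theorem MemHardyTwo.isBlaschkeSequence {h : 𝔻 → ℂ} (hh : MemHardyTwo h) :
    IsBlaschkeSequence fun i : (Σ z : 𝔻, Fin (analyticOrderNatAt (toPlane h) z)) => i.1 := by
  obtain ⟨hf, C, hC⟩ := hh
  have hnn : ∀ z : 𝔻, 0 ≤ 1 - ‖(z : ℂ)‖ := fun z => sub_nonneg.2 z.norm_lt_one.le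
  refine (summable_sigma_of_nonneg fun i => hnn i.1).2 ⟨fun z => Summable.of_finite, ?_⟩
  simp only [tsum_const, Nat.card_eq_fintype_card, Fintype.card_fin, nsmul_eq_mul]
  -- The origin, excluded from the Jensen bound, contributes its order.
  refine summable_of_sum_le (fun z => mul_nonneg (Nat.cast_nonneg _) (hnn z))
    (c := analyticOrderNatAt (toPlane h) 0 + (C - log ‖meromorphicTrailingCoeffAt (toPlane h) 0‖))
    fun u => ?_
  classical
  have hmem : u ⊆ insert 0 (u.erase 0) := Finset.insert_erase_subset 0 u
  refine (Finset.sum_le_sum_of_subset_of_nonneg hmem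
    fun z _ _ => mul_nonneg (Nat.cast_nonneg _) (hnn z)).trans ?_
  rw [Finset.sum_insert (Finset.notMem_erase 0 u)]
  refine add_le_add (by simp) ?_
  have hle := sum_analyticOrderNatAt_mul_one_sub_norm_le hf hC
    ((u.erase 0).map ⟨(fun z : 𝔻 => (z : ℂ)), Complex.UnitDisc.coe_injective⟩) ?_
  · simpa only [Finset.sum_map, Function.Embedding.coeFn_mk] using hle
  · intro x hx
    obtain ⟨z, hz, rfl⟩ := Finset.mem_map.1 hx
    exact ⟨by simpa using Finset.ne_of_mem_erase hz, z.norm_lt_one⟩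

theorem isZeroSequence_sigma {h : 𝔻 → ℂ}
    (hh : ∀ z : 𝔻, analyticOrderAt (toPlane h) (z : ℂ) ≠ ⊤) :
    IsZeroSequence h fun i : (Σ z : 𝔻, Fin (analyticOrderNatAt (toPlane h) z)) => i.1 := by
  intro z
  have hr : {i : (Σ z : 𝔻, Fin (analyticOrderNatAt (toPlane h) z)) | i.1 = z} =
      Set.range (Sigma.mk z) := by
    ext ⟨w, i⟩
    constructor
    · rintro rfl
      exact ⟨i, rfl⟩
    · rintro ⟨j, hj⟩
      exact (congrArg Sigma.fst hj).symm
  rw [hr, ← Set.image_univ, sigma_mk_injective.encard_image, Set.encard_univ]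
  simp [Nat.cast_analyticOrderNatAt (hh z)]

theorem IsBlaschkeSequence.countable {κ : Type*} {b : κ → 𝔻} (hb : IsBlaschkeSequence b) :
    Countable κ := by
  have h := hb.countable_support
  have hu : (Function.support fun i => 1 - ‖(b i : ℂ)‖) = Set.univ :=
    Set.eq_univ_of_forall fun i => (sub_pos.2 (b i).norm_lt_one).ne'
  rw [hu] at h
  exact Set.countable_univ_iff.1 h

theorem IsZeroSequence.sumElim {ι κ : Type*} {f g h : 𝔻 → ℂ} {w : ι → 𝔻} {b : κ → 𝔻}
    (hg : AnalyticOnNhd ℂ (toPlane g) (Metric.ball 0 1))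
    (hh : AnalyticOnNhd ℂ (toPlane h) (Metric.ball 0 1))
    (hfgh : ∀ z, f z = g z * h z)
    (hw : IsZeroSequence g w) (hb : IsZeroSequence h b) :
    IsZeroSequence f (Sum.elim w b) := by
  intro z
  have hz : (z : ℂ) ∈ Metric.ball (0 : ℂ) 1 := mem_ball_zero_iff.2 z.norm_lt_one
  have hev : toPlane f =ᶠ[𝓝 (z : ℂ)] toPlane g * toPlane h := by
    filter_upwards [Metric.isOpen_ball.mem_nhds hz] with x hx
    obtain ⟨y, rfl⟩ : ∃ y : 𝔻, (y : ℂ) = x := ⟨.mk x (mem_ball_zero_iff.1 hx), rfl⟩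
    simp only [Pi.mul_apply, toPlane_coe, hfgh]
  have hset : {i | Sum.elim w b i = z} = Sum.inl '' {i | w i = z} ∪ Sum.inr '' {i | b i = z} := by
    ext (i | i) <;> simp
  have hdisj : Disjoint (Sum.inl '' {i | w i = z}) (Sum.inr '' {i | b i = z}) := by
    rw [Set.disjoint_left]
    rintro _ ⟨i, _, rfl⟩ ⟨j, _, hj⟩
    cases hj
  rw [analyticOrderAt_congr hev, analyticOrderAt_mul (hg _ hz) (hh _ hz), hw z, hb z, hset,
    Set.encard_union_eq hdisj, Sum.inl_injective.encard_image, Sum.inr_injective.encard_image]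

end Zeros

/-! ### Expansivity of the shift and factorization in `[J]` -/

section Operators

variable {H : Type*} [NormedAddCommGroup H] [InnerProductSpace ℂ H] [CompleteSpace H]
  [RKHS ℂ H 𝔻 ℂ]

theorem diffQuot_zero_shift (hH : IsAnalyticShiftSpace H) (f : H) :
    diffQuot hH 0 (shift hH f) = f := by
  have h0 : (0 : ℂ) ∈ Metric.ball (0 : ℂ) 1 := Metric.mem_ball_self one_pos
  refine RKHS.ext fun z => ?_
  rw [diffQuot_apply, Complex.UnitDisc.coe_zero]
  rcases eq_or_ne (z : ℂ) 0 with hz | hz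
  · have hev : toPlane (shift hH f) =ᶠ[nhds 0] fun x => x * toPlane f x := by
      filter_upwards [Metric.isOpen_ball.mem_nhds h0] with x hx
      obtain ⟨y, rfl⟩ : ∃ y : 𝔻, (y : ℂ) = x := ⟨.mk x (mem_ball_zero_iff.1 hx), rfl⟩
      simp only [toPlane_coe, shift_apply]
    have hd := (hasDerivAt_id (0 : ℂ)).mul (hH.analytic f 0 h0).differentiableAt.hasDerivAt
    rw [hz, dslope_same, hev.deriv_eq, ← toPlane_coe f z, hz]
    simpa [Pi.mul_def] using hd.deriv
  · have h1 : toPlane (shift hH f) 0 = 0 := by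
      simpa using (toPlane_coe (shift hH f) 0).trans (shift_apply hH f 0)
    rw [dslope_of_ne _ hz, slope_def_field, toPlane_coe, h1, shift_apply, sub_zero, sub_zero,
      mul_div_cancel_left₀ _ hz]

theorem norm_le_norm_shift (hH : IsAnalyticShiftSpace H) (hQ : ‖diffQuot hH 0‖ = 1) (f : H) :
    ‖f‖ ≤ ‖shift hH f‖ := by
  simpa [diffQuot_zero_shift, hQ] using (diffQuot hH 0).le_opNorm (shift hH f)

open Polynomial in
theorem aeval_shift_apply (hH : IsAnalyticShiftSpace H) (p : ℂ[X]) (f : H) (z : 𝔻) :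
    aeval (shift hH) p f z = p.eval (z : ℂ) * f z := by
  induction p using Polynomial.induction_mul_X_add_C generalizing f with
  | zero => simp
  | step q a ih =>
    have h : aeval (shift hH) (q * X + C a) f = aeval (shift hH) q (shift hH f) + a • f := by
      rw [map_add, aeval_C, map_mul, aeval_X, Algebra.algebraMap_eq_smul_one]
      simp
    rw [h, RKHS.coe_add, Pi.add_apply, ih, RKHS.coe_smul, Pi.smul_apply, shift_apply, smul_eq_mul]
    simp only [eval_add, eval_mul, eval_C, eval_X]
    ring

open Filter Polynomial in
/-- If `‖Q₀‖ = 1` and `J` is inner, every element of `[J]` is a multiple of `J` by a function of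
the Hardy space. -/
theorem exists_memHardyTwo_mul_eq (hH : IsAnalyticShiftSpace H) (hQ : ‖diffQuot hH 0‖ = 1)
    {J : H} (hJ : IsInnerVector (shift hH) J) {f : H} (hf : f ∈ cyclicSubspace (shift hH) J) :
    ∃ h : 𝔻 → ℂ, MemHardyTwo h ∧ ∀ z : 𝔻, f z = J z * h z := by
  have hS := norm_le_norm_shift hH hQ
  have hJ2 : 0 < ‖J‖ ^ 2 := pow_pos (norm_pos_iff.2 hJ.1) 2
  obtain ⟨p, hp⟩ := exists_tendsto_aeval_of_mem_cyclicSubspace hf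
  obtain ⟨M, hM⟩ := hp.norm.bddAbove_range
  have hMn : ∀ n, ‖aeval (shift hH) (p n) J‖ ≤ M := fun n => hM ⟨n, rfl⟩
  have hC : ∀ n r, 0 ≤ r → r < 1 →
      Real.circleAverage (fun z => ‖(p n).eval z‖ ^ 2) 0 r ≤ M ^ 2 / ‖J‖ ^ 2 := by
    intro n r hr0 hr
    rw [le_div_iff₀ hJ2]
    refine (hJ.le_norm_sq_aeval hS
      (N := fun q => Real.circleAverage (fun z => ‖q.eval z‖ ^ 2) 0 r)
      (by simp [Real.circleAverage_const])
      (Polynomial.circleAverage_norm_sq_mul_X_add_C_le hr0 hr) (p n)).trans ?_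
    exact pow_le_pow_left₀ (norm_nonneg _) (hMn n) 2
  have hcau : ∀ ε > 0, ∃ N, ∀ m ≥ N, ∀ n ≥ N, ∀ z : ℂ, ‖z‖ < 1 →
      (1 - ‖z‖ ^ 2) * ‖(p m).eval z - (p n).eval z‖ ^ 2 ≤ ε := by
    intro ε hε
    -- The threshold absorbs the factor `‖J‖²` of the lower bound.
    obtain ⟨N, hN⟩ := Metric.cauchySeq_iff.1 hp.cauchySeq _
      (Real.sqrt_pos.2 (mul_pos hε hJ2))
    refine ⟨N, fun m hm n hn z hz => le_of_mul_le_mul_right ?_ hJ2⟩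
    have h1 := hJ.le_norm_sq_aeval hS (N := fun q => (1 - ‖z‖ ^ 2) * ‖q.eval z‖ ^ 2) (by simp)
      (Polynomial.mul_norm_sq_eval_mul_X_add_C_le hz) (p m - p n)
    have h2 := hN m hm n hn
    rw [dist_eq_norm, ← _root_.sub_apply, ← map_sub] at h2
    simp only [eval_sub] at h1
    exact h1.trans ((Real.le_sqrt (norm_nonneg _) (mul_pos hε hJ2).le).1 h2.le)
  obtain ⟨g, hg, hlim, hgC⟩ :=
    exists_tendsto_of_cauchy_weighted (fun n => (p n).differentiable) hC hcau
  let h : 𝔻 → ℂ := fun z => g z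
  have hEq : Set.EqOn (toPlane h) g (Metric.ball 0 1) := by
    intro x hx
    obtain ⟨y, rfl⟩ : ∃ y : 𝔻, (y : ℂ) = x := ⟨.mk x (mem_ball_zero_iff.1 hx), rfl⟩
    exact toPlane_coe h y
  refine ⟨h, ⟨(hg.congr hEq).analyticOnNhd Metric.isOpen_ball, 2 * (M ^ 2 / ‖J‖ ^ 2) + 2,
    fun r hr0 hr => ?_⟩, fun z => ?_⟩
  · refine le_of_eq_of_le (Real.circleAverage_congr_sphere fun z hz => ?_) (hgC r hr0 hr)
    rw [abs_of_nonneg hr0] at hz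
    simp only [hEq (Metric.closedBall_subset_ball hr (Metric.sphere_subset_closedBall hz))]
  · have h1 := ((RKHS.continuous_eval z).tendsto f).comp hp
    have h2 := (hlim z (mem_ball_zero_iff.2 z.norm_lt_one)).const_mul (J z)
    refine tendsto_nhds_unique h1 (h2.congr fun n => ?_)
    rw [Function.comp_apply, aeval_shift_apply, mul_comm]

end Operators

/-- Identity theorem on the connected disc. -/
theorem analyticOrderAt_toPlane_ne_top {f : 𝔻 → ℂ}
    (hf : AnalyticOnNhd ℂ (toPlane f) (Metric.ball 0 1)) {w : 𝔻} (hw : f w ≠ 0) (z : 𝔻) :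
    analyticOrderAt (toPlane f) (z : ℂ) ≠ ⊤ := by
  have hmem : ∀ z : 𝔻, (z : ℂ) ∈ Metric.ball (0 : ℂ) 1 :=
    fun z => mem_ball_zero_iff.2 z.norm_lt_one
  refine hf.analyticOrderAt_ne_top_of_isPreconnected (convex_ball 0 1).isPreconnected
    (hmem w) (hmem z) ?_
  rw [(hf _ (hmem w)).analyticOrderAt_eq_zero.2 (by rwa [toPlane_coe])]
  exact ENat.zero_ne_top

theorem mainTheorem9 {H : Type*} [NormedAddCommGroup H] [InnerProductSpace ℂ H] [CompleteSpace H]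
    [RKHS ℂ H 𝔻 ℂ] (hH : IsAnalyticShiftSpace H) (hQ : ‖diffQuot hH 0‖ = 1)
    (J : H) (hJ : IsInnerVector (shift hH) J)
    {ι : Type*} [Countable ι] (W : ι → 𝔻) (hW : IsZeroSequence J W)
    (f : H) (hf : f ∈ cyclicSubspace (shift hH) J) (hf0 : f ≠ 0) :
    (∃ h : 𝔻 → ℂ, MemHardyTwo h ∧ ∀ z : 𝔻, f z = J z * h z) ∧
      ∃ (κ : Type) (_ : Countable κ) (b : κ → 𝔻),
        IsBlaschkeSequence b ∧ IsZeroSequence f (Sum.elim W b) := by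
  obtain ⟨h, hh, hfJ⟩ := exists_memHardyTwo_mul_eq hH hQ hJ hf
  refine ⟨⟨h, hh, hfJ⟩, _, hh.isBlaschkeSequence.countable, _, hh.isBlaschkeSequence, ?_⟩
  obtain ⟨w, hw⟩ : ∃ w : 𝔻, f w ≠ 0 := by
    by_contra! hall
    exact hf0 (RKHS.ext fun z => by simpa using hall z)
  have hhw : h w ≠ 0 := right_ne_zero_of_mul (hfJ w ▸ hw)
  exact IsZeroSequence.sumElim (hH.analytic J) hh.1 hfJ hW
    (isZeroSequence_sigma (analyticOrderAt_toPlane_ne_top hh.1 hhw))
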